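/- Let $m,n\ge 0$ be integers. A rooted plane tree is either a leaf or a node with a non-empty ordered list of children; leaves are not nodes. A \emph{cut} of a tree is a set of nodes containing precisely one node on the path from the root to each leaf. A \emph{binary $m$-painted $n$-tree} $\mathbb{T}=(T,C,\mu)$ consists of a tree $T$ with $n+1$ leaves, a sequence $C=(C_1,\dots,C_m)$ of cuts of $T$ such that each node of $C_{k+1}$ lies on the path from the root to a node of $C_k$ and is not in $C_k$, and such that all nodes in $\bigcup_k C_k$ have exactly one child while all other nodes have exactly two children, and a bijective labeling $\mu$ of the $m$ cuts by $[m]$. The $n$ binary nodes are labeled by $1,\dots,n$ in inorder. Trees are drawn with the root at the top, so that \emph{below} means on the side of the leaves: a binary node is below a cut if it is a descendant of a node of the cut, a cut is below a binary node if it contains a descendant of this node, and a cut $C_k$ is weakly below a cut $C_l$ if each node of $C_k$ is equal to or a descendant of a node of $C_l$. Let $\preccurlyeq_{\mathbb{T}}$ be the preorder on $[m+n]$ generated by the relations $i\preccurlyeq j$ whenever some node carrying $i$ is equal to or a descendant of some node carrying $j$, where $i\le m$ is carried by the nodes of the cut labeled $i$, and $i\ge m+1$ is carried by the binary node with inorder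 label $i-m$. Let $\mathrm{Perm}(m)\subset\mathbb{R}^m$ be the convex hull of the points $\sum_{i} i\,\boldsymbol{e}_{\sigma(i)}$ over all permutations $\sigma$ of $[m]$. Let $\mathrm{Asso}(n)\subset\mathbb{R}^n$ be the convex hull of the points $\sum_i \ell(B,i)\,r(B,i)\,\boldsymbol{e}_i$ over all binary trees $B$ with $n+1$ leaves, where $\ell(B,i)$ and $r(B,i)$ are the numbers of leaves in the left and right subtrees of the $i$-th node of $B$ in inorder. The $(m,n)$-multiplihedron is the Minkowski sum \[ \mathrm{Mul}(m,n)=\big(\mathrm{Perm}(m)\times\mathrm{Asso}(n)\big)+\sum_{i\in[m],\,j\in[n]}[\boldsymbol{e}_i,\boldsymbol{e}_{m+j}]\subset\mathbb{R}^{m+n}. \] Then for every binary $m$-painted $n$-tree $\mathbb{T}$, there is a unique vertex $\boldsymbol{v}$ of $\mathrm{Mul}(m,n)$ corresponding to $\mathbb{T}$, that is, whose normal cone $\{\boldsymbol{x} : \langle\boldsymbol{x},\boldsymbol{p}\rangle\le\langle\boldsymbol{x},\boldsymbol{v}\rangle \text{ for all } \boldsymbol{p}\in\mathrm{Mul}(m,n)\}$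 is $\{\boldsymbol{x}\in\mathbb{R}^{m+n} : x_i\le x_j \text{ whenever } i\preccurlyeq_{\mathbb{T}} j\}$. For $i\in[m+n]$, its $i$-th coordinate is given by \begin{itemize} \item if $i\le m$, the number of binary nodes below the cut labeled by $i$, plus the number of cuts weakly below this cut (including itself), \item if $i\ge m+1$, the number of cuts below $\boldsymbol{n}$ plus the product of the numbers of leaves in the left and right subtrees of $\boldsymbol{n}$, where $\boldsymbol{n}$ is the binary node labeled by $i-m$ in inorder. \end{itemize} In particular, the sum of the coordinates is $\binom{m+1}{2}+\binom{n+1}{2}+mn$. -/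

import Mathlib

open scoped Pointwise

/-- Rooted plane trees all of whose nodes have one or two children. A leaf is not a node. -/
inductive PTree : Type
  | leaf : PTree
  | unary (t : PTree) : PTree
  | binary (l r : PTree) : PTree

namespace PTree

/-- The number of leaves. -/
def numLeaves : PTree → ℕ
  | leaf => 1
  | unary t => t.numLeaves
  | binary l r => l.numLeaves + r.numLeaves

/-- The subtree at an address. An address is the list of directions followed from the root: `false`
goes to the only child of a unary node or to the left child of a binary node, `true` goes to the
right child of a binary node. The root has address `[]`. The value is `none` if the address does not
exist in the tree. -/
def subtree : PTree → List Bool → Option PTree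
  | t, [] => some t
  | unary t, false :: p => t.subtree p
  | binary l _, false :: p => l.subtree p
  | binary _ r, true :: p => r.subtree p
  | _, _ => none

/-- `p` is the address of a leaf. -/
def IsLeafAt (T : PTree) (p : List Bool) : Prop := T.subtree p = some leaf

/-- `p` is the address of a node of degree one. -/
def IsUnaryAt (T : PTree) (p : List Bool) : Prop := ∃ t, T.subtree p = some (unary t)

/-- `p` is the address of a node of degree two. -/
def IsBinaryAt (T : PTree) (p : List Bool) : Prop := ∃ l r, T.subtree p = some (binary l r)

/-- `p` is the address of a node. -/
def IsNodeAt (T : PTree) (p : List Bool) : Prop := T.IsUnaryAt p ∨ T.IsBinaryAt p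

/-- The number of leaves in the left subtree of the binary node at `p`. -/
def leftLeaves (T : PTree) (p : List Bool) : ℕ :=
  match T.subtree p with
  | some (binary l _) => l.numLeaves
  | _ => 0

/-- The number of leaves in the right subtree of the binary node at `p`. -/
def rightLeaves (T : PTree) (p : List Bool) : ℕ :=
  match T.subtree p with
  | some (binary _ r) => r.numLeaves
  | _ => 0

/-- The addresses of the binary nodes, listed in inorder. -/
def inorder : PTree → List (List Bool)
  | leaf => []
  | unary t => t.inorder.map (List.cons false)
  | binary l r => l.inorder.map (List.cons false) ++ [] :: r.inorder.map (List.cons true)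

theorem length_inorder (T : PTree) : T.inorder.length + 1 = T.numLeaves := by
  induction T with
  | leaf => rfl
  | unary t ih => simpa [inorder, numLeaves] using ih
  | binary l r ihl ihr => simp [inorder, numLeaves]; omega

/-- The binary node with inorder label `j + 1`, for `j = 0, …, n - 1`, of a tree with `n + 1`
leaves. -/
def inorderNode {n : ℕ} (T : PTree) (hT : T.numLeaves = n + 1) (j : Fin n) : List Bool :=
  T.inorder[j.val]'(by have := T.length_inorder; omega)

/-- A cut: a set of nodes that contains precisely one node along the path from the root to any
leaf. The nodes along this path are the prefixes of the address of the leaf. -/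
def IsCut (T : PTree) (C : Set (List Bool)) : Prop :=
  (∀ p ∈ C, T.IsNodeAt p) ∧ ∀ q, T.IsLeafAt q → ∃! p, p ∈ C ∧ p <+: q

/-- The stump of a cut: all nodes on a path from the root to a node of the cut. -/
def stump (T : PTree) (C : Set (List Bool)) : Set (List Bool) :=
  {p | T.IsNodeAt p ∧ ∃ q ∈ C, p <+: q}

end PTree

/-- The permutahedron in `ℝⁿ`: the convex hull of the points `∑ i, i • e_{σ i}`. -/
def permutahedron (n : ℕ) : Set (Fin n → ℝ) :=
  convexHull ℝ (Set.range fun σ : Equiv.Perm (Fin n) =>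
    ∑ i : Fin n, ((i.val : ℝ) + 1) • (Pi.single (σ i) 1 : Fin n → ℝ))

/-- The associahedron in `ℝⁿ`: the convex hull of the points `∑ i, ℓ(T,i) r(T,i) • e_i` for all
binary trees `T` with `n + 1` leaves. -/
def associahedron (n : ℕ) : Set (Fin n → ℝ) :=
  convexHull ℝ {x | ∃ (T : PTree) (hT : T.numLeaves = n + 1), (∀ p, ¬ T.IsUnaryAt p) ∧
    x = fun i => (T.leftLeaves (T.inorderNode hT i) : ℝ) * T.rightLeaves (T.inorderNode hT i)}

/-- The shuffle `(P × Q) + ∑ i j, [e_i, e_{m+j}]`, with Minkowski sums. -/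
def shuffle {m n : ℕ} (P : Set (Fin m → ℝ)) (Q : Set (Fin n → ℝ)) : Set (Fin (m + n) → ℝ) :=
  {x | ∃ p ∈ P, ∃ q ∈ Q, x = Fin.append p q} +
    ∑ i : Fin m, ∑ j : Fin n,
      segment ℝ (Pi.single (Fin.castAdd n i) 1 : Fin (m + n) → ℝ) (Pi.single (Fin.natAdd m j) 1)

/-- The `(m,n)`-multiplihedron. -/
def multiplihedron (m n : ℕ) : Set (Fin (m + n) → ℝ) :=
  shuffle (permutahedron m) (associahedron n)

/-- The normal cone of a face `F` of a polytope `P`: the linear functions maximized over `P` by all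
of `F`. -/
def normalCone {ι : Type} [Fintype ι] (P F : Set (ι → ℝ)) : Set (ι → ℝ) :=
  {x | ∀ f ∈ F, ∀ p ∈ P, x ⬝ᵥ p ≤ x ⬝ᵥ f}

/-- A binary `m`-painted `n`-tree: a tree with `n + 1` leaves, a sequence of `m` cuts, each one
strictly closer to the root than the previous one, such that the nodes in the cuts have degree one
and the other nodes have degree two, and an ordered partition of the `m` labels into `m` parts,
that is, a bijection giving the label of each cut. -/
structure BinaryPaintedTree (m n : ℕ) where
  tree : PTree
  numLeaves_tree : tree.numLeaves = n + 1
  cut : Fin m → Set (List Bool)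
  isCut : ∀ k, tree.IsCut (cut k)
  cut_subset : ∀ k l : Fin m, k.val + 1 = l.val → cut l ⊆ tree.stump (cut k) \ cut k
  unary_of_mem : ∀ p, tree.IsNodeAt p → (∃ k, p ∈ cut k) → tree.IsUnaryAt p
  binary_of_notMem : ∀ p, tree.IsNodeAt p → (¬ ∃ k, p ∈ cut k) → tree.IsBinaryAt p
  label : Fin m ≃ Fin m

namespace BinaryPaintedTree

variable {m n : ℕ}

/-- The cut labeled by `a`. -/
def cutLabeled (PT : BinaryPaintedTree m n) (a : Fin m) : Set (List Bool) :=
  PT.cut (PT.label.symm a)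

/-- The binary node labeled by `j` in inorder. -/
def node (PT : BinaryPaintedTree m n) (j : Fin n) : List Bool :=
  PT.tree.inorderNode PT.numLeaves_tree j

/-- The set of nodes whose label contains `i`: the cut labeled by `i` if `i` is among the first `m`
indices, and otherwise the binary node whose inorder label, shifted by `m`, is `i`. -/
def nodesLabeled (PT : BinaryPaintedTree m n) (i : Fin (m + n)) : Set (List Bool) :=
  Fin.addCases (motive := fun _ => Set (List Bool))
    (fun a => PT.cutLabeled a) (fun j => {PT.node j}) i

/-- The preposet of `PT`, generated by the relations `i ≼ j` for which there is a path, oriented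
towards the root, from a node whose label contains `i` to a node whose label contains `j`. -/
def preposet (PT : BinaryPaintedTree m n) : Fin (m + n) → Fin (m + n) → Prop :=
  Relation.ReflTransGen fun i j =>
    ∃ p ∈ PT.nodesLabeled i, ∃ q ∈ PT.nodesLabeled j, q <+: p

/-- The cone of `PT`. -/
def cone (PT : BinaryPaintedTree m n) : Set (Fin (m + n) → ℝ) :=
  {x | ∀ i j, PT.preposet i j → x i ≤ x j}

/-- `v` is the vertex of the multiplihedron that corresponds to `PT`: it is a vertex
(a zero-dimensional face) and its normal cone is the cone of `PT`. -/
def IsCorrespondingVertex (PT : BinaryPaintedTree m n) (v : Fin (m + n) → ℝ) : Prop :=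
  v ∈ (multiplihedron m n).exposedPoints ℝ ∧ normalCone (multiplihedron m n) {v} = PT.cone

/-- The number of binary nodes below the cut labeled by `a`, that is, on the side of the leaves. -/
noncomputable def numNodesBelowCut (PT : BinaryPaintedTree m n) (a : Fin m) : ℕ :=
  {p | PT.tree.IsBinaryAt p ∧ ∃ q ∈ PT.cutLabeled a, q <+: p}.ncard

/-- The number of cuts weakly below the cut labeled by `a` (this cut included). -/
noncomputable def numCutsBelowCut (PT : BinaryPaintedTree m n) (a : Fin m) : ℕ :=
  {b : Fin m | ∀ p ∈ PT.cutLabeled b, ∃ q ∈ PT.cutLabeled a, q <+: p}.ncard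

/-- The number of cuts below the node `p`, that is, of cuts that contain a descendant of `p`. -/
noncomputable def numCutsBelowNode (PT : BinaryPaintedTree m n) (p : List Bool) : ℕ :=
  {b : Fin m | ∃ q ∈ PT.cutLabeled b, p <+: q}.ncard

end BinaryPaintedTree

/-! The normal cone of a Minkowski sum at a sum of points is the intersection of the normal cones of
the summands (`normalCone_add`, `normalCone_sum`). So the vertex is assembled summand by summand,
and each summand accounts for one kind of generating relation of the preposet. The order of the cuts
gives the permutahedron point (rearrangement inequality). The leaf products give the associahedron
point. For each pair of a cut and a binary node, the segment contributes the endpoint of whichever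
is nearer the root; `not_nodeBelowCut_iff` makes this choice unambiguous.

For the associahedron, the maximum of a linear function `x` is the sum of the maxima of `x` over all
non-empty intervals of indices. `objective_le` bounds every tree by this sum, with equality exactly
when `x` weakly decreases away from the root, and `exists_isMonotoneOn` supplies a tree attaining
it.

The integer function `height` increases strictly along the relations between distinct labels, so it
and its translates by the vectors `± e_i` all lie in the cone. Hence it is maximized at the vertex
only, which gives both exposedness and uniqueness. -/

section NormalCone

/-! ### Normal cones of sums, hulls, segments and products -/

variable {ι : Type} [Fintype ι]

theorem mem_normalCone_singleton {P : Set (ι → ℝ)} {v x : ι → ℝ} :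
    x ∈ normalCone P {v} ↔ ∀ p ∈ P, x ⬝ᵥ p ≤ x ⬝ᵥ v := by
  simp [normalCone]

theorem normalCone_add {A B : Set (ι → ℝ)} {a b : ι → ℝ} (ha : a ∈ A) (hb : b ∈ B) :
    normalCone (A + B) {a + b} = normalCone A {a} ∩ normalCone B {b} := by
  ext x
  simp only [Set.mem_inter_iff, mem_normalCone_singleton]
  constructor
  · intro h
    constructor
    · intro p hp
      have := h _ (Set.add_mem_add hp hb)
      simpa [dotProduct_add] using this
    · intro p hp
      have := h _ (Set.add_mem_add ha hp)
      simpa [dotProduct_add] using this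
  · rintro ⟨h₁, h₂⟩ _ ⟨p, hp, q, hq, rfl⟩
    simp only [dotProduct_add]
    exact add_le_add (h₁ p hp) (h₂ q hq)

theorem normalCone_sum {κ : Type} (s : Finset κ) {A : κ → Set (ι → ℝ)} {a : κ → ι → ℝ}
    (h : ∀ k, a k ∈ A k) :
    normalCone (∑ k ∈ s, A k) {∑ k ∈ s, a k} = {x | ∀ k ∈ s, x ∈ normalCone (A k) {a k}} := by
  classical
  induction s using Finset.induction_on with
  | empty =>
    ext x
    simp [mem_normalCone_singleton]
  | insert k s hk ih =>
    rw [Finset.sum_insert hk, Finset.sum_insert hk,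
      normalCone_add (h k) (Set.finsetSum_mem_finsetSum _ _ _ fun i _ => h i), ih]
    ext x
    simp

theorem normalCone_convexHull (S F : Set (ι → ℝ)) :
    normalCone (convexHull ℝ S) F = normalCone S F := by
  ext x
  refine ⟨fun h f hf p hp => h f hf p (subset_convexHull ℝ S hp), fun h f hf p hp => ?_⟩
  have hc : Convex ℝ {p : ι → ℝ | x ⬝ᵥ p ≤ x ⬝ᵥ f} :=
    convex_halfSpace_le ⟨fun a b => dotProduct_add _ _ _, fun c a => dotProduct_smul _ _ _⟩ _
  exact convexHull_min (h f hf) hc hp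

theorem normalCone_segment_left [DecidableEq ι] (i j : ι) :
    normalCone (segment ℝ (Pi.single i 1) (Pi.single j 1)) {(Pi.single i 1 : ι → ℝ)} =
      {x | x j ≤ x i} := by
  rw [← convexHull_pair, normalCone_convexHull]
  ext x
  simp [mem_normalCone_singleton]

theorem normalCone_segment_right [DecidableEq ι] (i j : ι) :
    normalCone (segment ℝ (Pi.single i 1) (Pi.single j 1)) {(Pi.single j 1 : ι → ℝ)} =
      {x | x i ≤ x j} := by
  rw [segment_symm, normalCone_segment_left]

theorem dotProduct_append {m n : ℕ} (x : Fin (m + n) → ℝ) (p : Fin m → ℝ) (q : Fin n → ℝ) :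
    x ⬝ᵥ Fin.append p q =
      (fun i => x (Fin.castAdd n i)) ⬝ᵥ p + (fun j => x (Fin.natAdd m j)) ⬝ᵥ q := by
  simp [dotProduct, Fin.sum_univ_add]

theorem normalCone_append {m n : ℕ} {P : Set (Fin m → ℝ)} {Q : Set (Fin n → ℝ)}
    {p : Fin m → ℝ} {q : Fin n → ℝ} (hp : p ∈ P) (hq : q ∈ Q) :
    normalCone {x | ∃ p ∈ P, ∃ q ∈ Q, x = Fin.append p q} {Fin.append p q} =
      {x | (fun i => x (Fin.castAdd n i)) ∈ normalCone P {p} ∧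
        (fun j => x (Fin.natAdd m j)) ∈ normalCone Q {q}} := by
  ext x
  simp only [mem_normalCone_singleton, Set.mem_ofPred_eq]
  constructor
  · intro h
    constructor
    · intro p' hp'
      have := h _ ⟨p', hp', q, hq, rfl⟩
      simpa [dotProduct_append] using this
    · intro q' hq'
      have := h _ ⟨p, hp, q', hq', rfl⟩
      simpa [dotProduct_append] using this
  · rintro ⟨h₁, h₂⟩ _ ⟨p', hp', q', hq', rfl⟩
    simp only [dotProduct_append]
    exact add_le_add (h₁ p' hp') (h₂ q' hq')

/-- If the normal cone of `v` is a neighbourhood of `x`, then `v` is the only maximizer of `x`. -/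
theorem eq_of_dotProduct_le [DecidableEq ι] {P : Set (ι → ℝ)} {v x : ι → ℝ}
    (hadd : ∀ i, x + Pi.single i 1 ∈ normalCone P {v})
    (hsub : ∀ i, x - Pi.single i 1 ∈ normalCone P {v}) {p : ι → ℝ} (hp : p ∈ P)
    (h : x ⬝ᵥ v ≤ x ⬝ᵥ p) : p = v := by
  funext i
  -- Testing `x + e_i` gives `p i ≤ v i`, and `x - e_i` gives the reverse.
  have h₁ := mem_normalCone_singleton.1 (hadd i) p hp
  have h₂ := mem_normalCone_singleton.1 (hsub i) p hp
  simp only [add_dotProduct, sub_dotProduct, single_dotProduct, one_mul] at h₁ h₂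
  linarith

theorem mem_exposedPoints_of_normalCone [DecidableEq ι] {P : Set (ι → ℝ)} {v x : ι → ℝ}
    (hv : v ∈ P) (hx : x ∈ normalCone P {v})
    (hadd : ∀ i, x + Pi.single i 1 ∈ normalCone P {v})
    (hsub : ∀ i, x - Pi.single i 1 ∈ normalCone P {v}) : v ∈ P.exposedPoints ℝ := by
  let l : (ι → ℝ) →ₗ[ℝ] ℝ :=
    { toFun := fun p => x ⬝ᵥ p
      map_add' := fun a b => dotProduct_add _ _ _
      map_smul' := fun c a => dotProduct_smul _ _ _ }
  exact ⟨hv, LinearMap.toContinuousLinearMap l, fun y hy =>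
    ⟨mem_normalCone_singleton.1 hx y hy, fun h => eq_of_dotProduct_le hadd hsub hy h⟩⟩

end NormalCone

/-! ### Permutahedron: the rearrangement inequality -/

section Permutahedron

variable {m : ℕ}

theorem sum_smul_single_perm (σ : Equiv.Perm (Fin m)) :
    (∑ i : Fin m, ((i.val : ℝ) + 1) • (Pi.single (σ i) 1 : Fin m → ℝ)) =
      fun a => ((σ.symm a).val : ℝ) + 1 := by
  funext a
  rw [← Equiv.sum_comp σ.symm]
  simp [Finset.sum_apply, Pi.single_apply]

theorem perm_mem_permutahedron (σ : Equiv.Perm (Fin m)) :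
    (fun a => ((σ.symm a).val : ℝ) + 1) ∈ permutahedron m :=
  subset_convexHull ℝ _ ⟨σ, sum_smul_single_perm σ⟩

theorem normalCone_permutahedron (σ : Equiv.Perm (Fin m)) :
    normalCone (permutahedron m) {fun a => ((σ.symm a).val : ℝ) + 1} =
      {x | Monotone fun k => x (σ k)} := by
  have hdot : ∀ (x : Fin m → ℝ) (τ : Equiv.Perm (Fin m)),
      x ⬝ᵥ (fun a => ((τ.symm a).val : ℝ) + 1) = ∑ i, x (τ i) * ((i.val : ℝ) + 1) := by
    intro x τ
    simp only [dotProduct]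
    rw [← Equiv.sum_comp τ]
    simp
  have hg : StrictMono fun i : Fin m => (i.val : ℝ) + 1 := by
    intro i j hij
    simpa using hij
  have hmono : ∀ f : Fin m → ℝ, Monovary f (fun i : Fin m => (i.val : ℝ) + 1) ↔ Monotone f := by
    refine fun f => ⟨fun h => monotone_iff_forall_lt.2 fun i j hij => h (hg hij), fun h => ?_⟩
    exact h.monovary hg.monotone
  ext x
  rw [permutahedron, normalCone_convexHull]
  simp only [mem_normalCone_singleton, Set.forall_mem_range, sum_smul_single_perm, hdot,
    Set.mem_ofPred_eq]
  constructor
  · intro h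
    by_contra hσ
    -- The permutation sorting `x` does strictly better than `σ` when `x ∘ σ` is not monotone.
    have hs : Monotone fun k => x (Tuple.sort x k) := Tuple.monotone_sort x
    have hlt := ((hmono _).2 hs).sum_comp_perm_mul_lt_sum_mul_iff
      (σ := σ.trans (Tuple.sort x).symm)
    have := hlt.2 (by
      rw [hmono]
      convert hσ using 2
      funext k
      simp)
    simp only [Equiv.trans_apply, Equiv.apply_symm_apply] at this
    exact absurd (h (Tuple.sort x)) (not_le.2 this)
  · intro h τ
    have := ((hmono _).2 h).sum_comp_perm_mul_le_sum_mul (σ := τ.trans σ.symm)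
    simpa using this

end Permutahedron

/-! ### Sums of maxima over intervals -/

section IntervalMax

/-- The sum, over all non-empty intervals `[a, a + k]` contained in `[0, n)`, of the maximum of `x`
on the interval. -/
noncomputable def intervalMaxSum (x : ℕ → ℝ) (n : ℕ) : ℝ :=
  ∑ a ∈ Finset.range n, ∑ k ∈ Finset.range (n - a), partialSups (fun i => x (a + i)) k

/-- The sum, over the intervals contained in `[0, p + 1 + q)` and containing `p`, of the maximum of
`x` on the interval. -/
noncomputable def crossingMaxSum (x : ℕ → ℝ) (p q : ℕ) : ℝ :=
  ∑ a ∈ Finset.range (p + 1), ∑ k ∈ Finset.range (q + 1),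
    partialSups (fun i => x (a + i)) (p - a + k)

/-- An interval ends before `p`, contains `p`, or starts after `p`. This mirrors the decomposition
of a binary tree at a root with inorder index `p`. -/
theorem intervalMaxSum_split (x : ℕ → ℝ) (p q : ℕ) :
    intervalMaxSum x (p + 1 + q) =
      intervalMaxSum x p + crossingMaxSum x p q +
        intervalMaxSum (fun k => x (k + (p + 1))) q := by
  have hr : ∀ b ∈ Finset.range q,
      ∑ k ∈ Finset.range (p + 1 + q - (p + 1 + b)), partialSups (fun i => x (p + 1 + b + i)) k =
        ∑ k ∈ Finset.range (q - b), partialSups (fun i => x (b + i + (p + 1))) k := by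
    intro b _
    have h₁ : p + 1 + q - (p + 1 + b) = q - b := by omega
    have h₂ : (fun i => x (p + 1 + b + i)) = fun i => x (b + i + (p + 1)) := by
      funext i
      congr 1
      omega
    rw [h₁, h₂]
  have hl : ∀ a ∈ Finset.range (p + 1),
      ∑ k ∈ Finset.range (p + 1 + q - a), partialSups (fun i => x (a + i)) k =
        ∑ k ∈ Finset.range (p - a), partialSups (fun i => x (a + i)) k +
          ∑ k ∈ Finset.range (q + 1), partialSups (fun i => x (a + i)) (p - a + k) := by
    intro a ha
    have ha := Finset.mem_range.1 ha
    rw [← Finset.sum_range_add]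
    congr 2
    omega
  rw [intervalMaxSum, Finset.sum_range_add, Finset.sum_congr rfl hl, Finset.sum_congr rfl hr,
    Finset.sum_add_distrib, Finset.sum_range_succ (n := p)]
  simp [intervalMaxSum, crossingMaxSum]

/-- There are `(p + 1) * (q + 1)` intervals containing `p`, and each has maximum at least `x p`. -/
theorem mul_le_crossingMaxSum (x : ℕ → ℝ) (p q : ℕ) :
    x p * ((p + 1) * (q + 1)) ≤ crossingMaxSum x p q ∧
      (x p * ((p + 1) * (q + 1)) = crossingMaxSum x p q ↔ ∀ k < p + 1 + q, x k ≤ x p) := by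
  have hterm : ∀ a ∈ Finset.range (p + 1), ∀ k ∈ Finset.range (q + 1),
      x p ≤ partialSups (fun i => x (a + i)) (p - a + k) := by
    intro a ha k _
    have ha := Finset.mem_range.1 ha
    have := le_partialSups_of_le (fun i => x (a + i)) (show p - a ≤ p - a + k by omega)
    rwa [show a + (p - a) = p by omega] at this
  have hconst : x p * (((p : ℝ) + 1) * (q + 1)) =
      ∑ a ∈ Finset.range (p + 1), ∑ k ∈ Finset.range (q + 1), x p := by
    simp
    ring
  rw [hconst]
  refine ⟨Finset.sum_le_sum fun a ha => Finset.sum_le_sum (hterm a ha), fun h k hk => ?_,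
    fun h => Finset.sum_congr rfl fun a ha => Finset.sum_congr rfl fun k hk => ?_⟩
  -- Equality of the sums forces equality termwise; the term `a = 0`, `k = q` is the whole interval.
  · have h₀ := (Finset.sum_eq_sum_iff_of_le
      fun a ha => Finset.sum_le_sum (hterm a ha)).1 h 0 (by simp)
    have h₁ := (Finset.sum_eq_sum_iff_of_le (hterm 0 (by simp))).1 h₀ q (by simp)
    rw [h₁]
    have := le_partialSups_of_le (fun i => x (0 + i)) (show k ≤ p - 0 + q by omega)
    rwa [zero_add] at this
  · refine le_antisymm (hterm a ha k hk) (partialSups_le _ _ _ fun i hi => h _ ?_)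
    simp only [Finset.mem_range] at ha hk
    omega

end IntervalMax

/-! ### Associahedron: leaf products and their optimization -/

namespace PTree

/-- The products of the numbers of leaves of the left and right subtrees of the binary nodes, listed
in inorder. -/
def products : PTree → List ℕ
  | leaf => []
  | unary t => t.products
  | binary l r => l.products ++ (l.numLeaves * r.numLeaves) :: r.products

theorem map_inorder (T : PTree) :
    T.inorder.map (fun p => T.leftLeaves p * T.rightLeaves p) = T.products := by
  induction T with
  | leaf => rfl
  | unary t ih =>
    rw [products, ← ih]
    simp [inorder, leftLeaves, rightLeaves, subtree]
  | binary l r ihl ihr =>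
    rw [products, ← ihl, ← ihr, inorder, List.map_append, List.map_cons, List.map_map, List.map_map]
    rfl

theorem length_products (T : PTree) : T.products.length = T.inorder.length := by
  rw [← map_inorder, List.length_map]

theorem sum_products (T : PTree) : T.products.sum = T.numLeaves.choose 2 := by
  induction T with
  | leaf => rfl
  | unary t ih => exact ih
  | binary l r ihl ihr =>
    -- Vandermonde: a pair of leaves lies on the left, on the right, or is separated by the root.
    have := Nat.add_choose_eq l.numLeaves r.numLeaves 2
    simp [Finset.Nat.antidiagonal_succ] at this
    simp only [products, numLeaves, List.sum_append, List.sum_cons, ihl, ihr]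
    omega

/-- The value of the linear function `x` at the vector of leaf products. -/
noncomputable def objective (x : ℕ → ℝ) (T : PTree) : ℝ :=
  ∑ i ∈ Finset.range T.inorder.length, x i * (T.products.getD i 0 : ℕ)

theorem length_inorder_binary (l r : PTree) :
    (binary l r).inorder.length = l.inorder.length + 1 + r.inorder.length := by
  simp [inorder]
  omega

theorem objective_binary (x : ℕ → ℝ) (l r : PTree) :
    (binary l r).objective x =
      l.objective x +
        x l.inorder.length * ((l.inorder.length + 1 : ℝ) * (r.inorder.length + 1)) +
          r.objective fun k => x (k + (l.inorder.length + 1)) := by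
  have hl := l.length_inorder
  have hr := r.length_inorder
  rw [objective, length_inorder_binary, Finset.sum_range_add, Finset.sum_range_succ]
  congr 1
  · congr 1
    · refine Finset.sum_congr rfl fun i hi => ?_
      have hi := Finset.mem_range.1 hi
      rw [products, List.getD_append _ _ _ _ (by rwa [length_products])]
    · rw [products, List.getD_append_right _ _ _ _ (by rw [length_products]), length_products,
        ← hl, ← hr]
      simp
  · refine Finset.sum_congr rfl fun i hi => ?_
    rw [products, List.getD_append_right _ _ _ _ (by rw [length_products]; omega), length_products,
      show l.inorder.length + 1 + i - l.inorder.length = i + 1 by omega, add_comm _ i]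
    simp

/-- The values `x 0, x 1, …` at the binary nodes, in inorder, weakly decrease away from the root. -/
def IsMonotoneOn (x : ℕ → ℝ) : PTree → Prop
  | leaf => True
  | unary t => t.IsMonotoneOn x
  | binary l r => (∀ k < l.inorder.length + 1 + r.inorder.length, x k ≤ x l.inorder.length) ∧
      l.IsMonotoneOn x ∧ r.IsMonotoneOn fun k => x (k + (l.inorder.length + 1))

/-- Induction on the tree: the root term is compared with the intervals crossing the root, the
subtrees with the remaining intervals. Equality of the total forces equality in all three
comparisons. -/
theorem objective_le (T : PTree) (x : ℕ → ℝ) :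
    T.objective x ≤ intervalMaxSum x T.inorder.length ∧
      (T.objective x = intervalMaxSum x T.inorder.length ↔ T.IsMonotoneOn x) := by
  induction T generalizing x with
  | leaf => simp [objective, intervalMaxSum, inorder, IsMonotoneOn]
  | unary t ih => simpa [objective, inorder, products, IsMonotoneOn] using ih x
  | binary l r ihl ihr =>
    obtain ⟨hl, hl'⟩ := ihl x
    obtain ⟨hr, hr'⟩ := ihr fun k => x (k + (l.inorder.length + 1))
    obtain ⟨hc, hc'⟩ := mul_le_crossingMaxSum x l.inorder.length r.inorder.length
    rw [objective_binary, length_inorder_binary, intervalMaxSum_split, IsMonotoneOn, ← hc', ← hl',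
      ← hr']
    refine ⟨by linarith, fun h => ⟨by linarith, by linarith, by linarith⟩, fun h => ?_⟩
    rw [h.1, h.2.1, h.2.2]

/-- The decreasing tree of `x`: put a maximum at the root and recurse on both sides. It shows that
the bound in `objective_le` is attained. -/
theorem exists_isMonotoneOn (n : ℕ) (x : ℕ → ℝ) :
    ∃ T : PTree, T.inorder.length = n ∧ T.IsMonotoneOn x := by
  induction n using Nat.strong_induction_on generalizing x with
  | _ n ih =>
    rcases Nat.eq_zero_or_pos n with rfl | hn
    · exact ⟨leaf, rfl, trivial⟩
    · obtain ⟨i, hi, hmax⟩ := Finset.exists_max_image (Finset.range n) x ⟨0, by simpa using hn⟩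
      simp only [Finset.mem_range] at hi hmax
      obtain ⟨l, hl, hl'⟩ := ih i hi x
      obtain ⟨r, hr, hr'⟩ := ih (n - i - 1) (by omega) fun k => x (k + (i + 1))
      refine ⟨binary l r, ?_, ?_⟩
      · rw [length_inorder_binary]
        omega
      · simp only [IsMonotoneOn, hl, hr]
        exact ⟨fun k hk => hmax k (by omega), hl', hr'⟩

theorem getElem?_inorder_binary {l r : PTree} {i : ℕ} {p : List Bool} :
    (binary l r).inorder[i]? = some p ↔
      (∃ p', l.inorder[i]? = some p' ∧ p = false :: p') ∨ (i = l.inorder.length ∧ p = []) ∨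
        ∃ k p', i = k + (l.inorder.length + 1) ∧ r.inorder[k]? = some p' ∧ p = true :: p' := by
  rw [inorder]
  rcases lt_trichotomy i l.inorder.length with h | rfl | h
  · rw [List.getElem?_append_left (by simpa using h), List.getElem?_map, Option.map_eq_some_iff]
    constructor
    · rintro ⟨p', h', rfl⟩
      exact Or.inl ⟨p', h', rfl⟩
    · rintro (⟨p', h', rfl⟩ | ⟨rfl, -⟩ | ⟨k, p', rfl, -⟩)
      · exact ⟨p', h', rfl⟩
      · omega
      · omega
  · rw [List.getElem?_append_right (by simp)]
    simp [eq_comm]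
    omega
  · obtain ⟨k, rfl⟩ := Nat.exists_eq_add_of_lt h
    rw [List.getElem?_append_right (by simp; omega), List.length_map,
      show l.inorder.length + k + 1 - l.inorder.length = k + 1 by omega, List.getElem?_cons_succ,
      List.getElem?_map, Option.map_eq_some_iff]
    constructor
    · rintro ⟨p', h', rfl⟩
      exact Or.inr (Or.inr ⟨k, p', by omega, h', rfl⟩)
    · rintro (⟨p', h', rfl⟩ | ⟨h', -⟩ | ⟨k', p', hk, h', rfl⟩)
      · have := (List.getElem?_eq_some_iff.1 h').1
        omega
      · omega
      · obtain rfl : k = k' := by omega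
        exact ⟨p', h', rfl⟩

theorem isMonotoneOn_iff (T : PTree) (x : ℕ → ℝ) :
    T.IsMonotoneOn x ↔ ∀ i j p q, T.inorder[i]? = some p → T.inorder[j]? = some q → q <+: p →
      x i ≤ x j := by
  induction T generalizing x with
  | leaf => simp [IsMonotoneOn, inorder]
  | unary t ih =>
    simp only [IsMonotoneOn, ih, inorder, List.getElem?_map, Option.map_eq_some_iff]
    constructor
    · rintro h i j _ _ ⟨p, hp, rfl⟩ ⟨q, hq, rfl⟩ hqp
      exact h i j p q hp hq (List.cons_prefix_cons.1 hqp).2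
    · intro h i j p q hp hq hqp
      exact h i j _ _ ⟨p, hp, rfl⟩ ⟨q, hq, rfl⟩ (List.cons_prefix_cons.2 ⟨rfl, hqp⟩)
  | binary l r ihl ihr =>
    simp only [IsMonotoneOn, ihl, ihr]
    constructor
    · rintro ⟨h, hl, hr⟩ i j p q hp hq hqp
      have hi := (List.getElem?_eq_some_iff.1 hp).1
      rw [length_inorder_binary] at hi
      rw [getElem?_inorder_binary] at hp hq
      rcases hq with ⟨q', hq, rfl⟩ | ⟨rfl, rfl⟩ | ⟨j, q', rfl, hq, rfl⟩
      · rcases hp with ⟨p', hp, rfl⟩ | ⟨rfl, rfl⟩ | ⟨i, p', rfl, hp, rfl⟩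
        · exact hl _ _ _ _ hp hq (List.cons_prefix_cons.1 hqp).2
        · simp at hqp
        · simp at hqp
      · exact h i hi
      · rcases hp with ⟨p', hp, rfl⟩ | ⟨rfl, rfl⟩ | ⟨i, p', rfl, hp, rfl⟩
        · simp at hqp
        · simp at hqp
        · exact hr _ _ _ _ hp hq (List.cons_prefix_cons.1 hqp).2
    · intro h
      refine ⟨fun k hk => ?_, fun i j p q hp hq hqp => ?_, fun i j p q hp hq hqp => ?_⟩
      · rw [← length_inorder_binary] at hk
        exact h k _ _ [] (List.getElem?_eq_getElem hk)
          (getElem?_inorder_binary.2 (Or.inr (Or.inl ⟨rfl, rfl⟩))) List.nil_prefix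
      · exact h i j _ _ (getElem?_inorder_binary.2 (Or.inl ⟨p, hp, rfl⟩))
          (getElem?_inorder_binary.2 (Or.inl ⟨q, hq, rfl⟩)) (List.cons_prefix_cons.2 ⟨rfl, hqp⟩)
      · exact h _ _ _ _ (getElem?_inorder_binary.2 (Or.inr (Or.inr ⟨i, p, rfl, hp, rfl⟩)))
          (getElem?_inorder_binary.2 (Or.inr (Or.inr ⟨j, q, rfl, hq, rfl⟩)))
          (List.cons_prefix_cons.2 ⟨rfl, hqp⟩)

/-- The binary tree obtained by contracting all nodes of degree one. -/
def contractUnary : PTree → PTree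
  | leaf => leaf
  | unary t => t.contractUnary
  | binary l r => binary l.contractUnary r.contractUnary

theorem numLeaves_contractUnary (T : PTree) : T.contractUnary.numLeaves = T.numLeaves := by
  induction T with
  | leaf => rfl
  | unary t ih => exact ih
  | binary l r ihl ihr => simp [contractUnary, numLeaves, ihl, ihr]

theorem products_contractUnary (T : PTree) : T.contractUnary.products = T.products := by
  induction T with
  | leaf => rfl
  | unary t ih => exact ih
  | binary l r ihl ihr => simp [contractUnary, products, ihl, ihr, numLeaves_contractUnary]

theorem not_isUnaryAt_contractUnary (T : PTree) (p : List Bool) :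
    ¬ T.contractUnary.IsUnaryAt p := by
  induction T generalizing p with
  | leaf => cases p <;> simp [contractUnary, IsUnaryAt, subtree]
  | unary t ih => exact ih p
  | binary l r ihl ihr =>
    rcases p with _ | ⟨_ | _, p⟩
    · simp [contractUnary, IsUnaryAt, subtree]
    · exact ihl p
    · exact ihr p

/-- The vector of the products of the numbers of leaves of the left and right subtrees. -/
def leafProducts {n : ℕ} (T : PTree) (hT : T.numLeaves = n + 1) (i : Fin n) : ℝ :=
  (T.leftLeaves (T.inorderNode hT i) : ℝ) * T.rightLeaves (T.inorderNode hT i)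

variable {n : ℕ}

theorem leafProducts_eq (T : PTree) (hT : T.numLeaves = n + 1) (i : Fin n) :
    T.leafProducts hT i = (T.products.getD i 0 : ℕ) := by
  have hi : i.val < T.inorder.length := by
    have := T.length_inorder
    omega
  simp only [leafProducts, inorderNode, ← map_inorder]
  rw [List.getD_eq_getElem _ _ (by simpa using hi)]
  simp

/-- Contracting the unary nodes changes no leaf product and yields a genuine binary tree. -/
theorem leafProducts_mem_associahedron (T : PTree) (hT : T.numLeaves = n + 1) :
    T.leafProducts hT ∈ associahedron n := by
  refine subset_convexHull ℝ _ ⟨T.contractUnary, by rw [numLeaves_contractUnary, hT],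
    T.not_isUnaryAt_contractUnary, ?_⟩
  funext i
  change _ = T.contractUnary.leafProducts _ i
  rw [leafProducts_eq, leafProducts_eq, products_contractUnary]

theorem sum_leafProducts (T : PTree) (hT : T.numLeaves = n + 1) :
    ∑ i, T.leafProducts hT i = ((n + 1).choose 2 : ℝ) := by
  have hlen : T.products.length = n := by
    have := T.length_inorder
    rw [length_products]
    omega
  subst hlen
  rw [← hT, ← sum_products, ← Fin.sum_univ_getElem]
  push_cast
  refine Finset.sum_congr rfl fun i _ => ?_
  rw [leafProducts_eq, List.getD_eq_getElem _ _ i.2]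

theorem normalCone_associahedron (T : PTree) (hT : T.numLeaves = n + 1) :
    normalCone (associahedron n) {T.leafProducts hT} =
      {x | ∀ i j, T.inorderNode hT j <+: T.inorderNode hT i → x i ≤ x j} := by
  have hlen : ∀ S : PTree, S.numLeaves = n + 1 → S.inorder.length = n := by
    intro S hS
    have := S.length_inorder
    omega
  ext x
  -- Extension to `ℕ`, as the inductions shift indices; the values from `n` on play no role.
  let y : ℕ → ℝ := fun k => if h : k < n then x ⟨k, h⟩ else 0
  have hy : ∀ i : Fin n, y i = x i := fun i => dif_pos i.2
  have hdot : ∀ (S : PTree) (hS : S.numLeaves = n + 1),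
      x ⬝ᵥ S.leafProducts hS = S.objective y := by
    intro S hS
    rw [objective, hlen S hS, Finset.sum_range, dotProduct]
    exact Finset.sum_congr rfl fun i _ => by rw [leafProducts_eq, hy]
  have hmono : T.IsMonotoneOn y ↔
      ∀ i j, T.inorderNode hT j <+: T.inorderNode hT i → x i ≤ x j := by
    rw [isMonotoneOn_iff]
    constructor
    · intro h i j hij
      rw [← hy, ← hy]
      exact h i j _ _ (List.getElem?_eq_getElem _) (List.getElem?_eq_getElem _) hij
    · intro h i j p q hp hq hqp
      obtain ⟨hi, rfl⟩ := List.getElem?_eq_some_iff.1 hp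
      obtain ⟨hj, rfl⟩ := List.getElem?_eq_some_iff.1 hq
      rw [hlen T hT] at hi hj
      have := h ⟨i, hi⟩ ⟨j, hj⟩ hqp
      rwa [← hy, ← hy] at this
  have hmax := T.objective_le y
  rw [hlen T hT] at hmax
  rw [Set.mem_ofPred_eq, ← hmono, ← hmax.2, mem_normalCone_singleton]
  constructor
  · intro h
    obtain ⟨S, hS, hS'⟩ := exists_isMonotoneOn n y
    have hSn : S.numLeaves = n + 1 := by rw [← S.length_inorder, hS]
    have := h _ (S.leafProducts_mem_associahedron hSn)
    rw [hdot, hdot, (S.objective_le y).2.2 hS', hS] at this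
    exact le_antisymm hmax.1 this
  · intro h
    rw [← mem_normalCone_singleton, associahedron, normalCone_convexHull, mem_normalCone_singleton]
    rintro _ ⟨S, hS, -, rfl⟩
    change x ⬝ᵥ S.leafProducts hS ≤ _
    rw [hdot, hdot, h, ← hlen S hS]
    exact (S.objective_le y).1

end PTree

/-! ### Addresses and cuts -/

namespace PTree

variable {T : PTree} {p q : List Bool} {C : Set (List Bool)}

theorem subtree_append {t : PTree} (h : T.subtree p = some t) (q : List Bool) :
    T.subtree (p ++ q) = t.subtree q := by
  induction p generalizing T with
  | nil =>
    have : T = t := by simpa [subtree] using h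
    rw [this, List.nil_append]
  | cons b p ih =>
    cases T <;> cases b <;> first | exact ih h | simp [subtree] at h

theorem exists_isLeafAt (T : PTree) : ∃ q, T.IsLeafAt q := by
  induction T with
  | leaf => exact ⟨[], rfl⟩
  | unary t ih => exact ih.imp' (List.cons false) fun _ h => h
  | binary l r ihl _ => exact ihl.imp' (List.cons false) fun _ h => h

theorem IsNodeAt.exists_isLeafAt (h : T.IsNodeAt p) : ∃ q, T.IsLeafAt q ∧ p <+: q := by
  obtain ⟨t, ht⟩ : ∃ t, T.subtree p = some t := by
    rcases h with ⟨t, ht⟩ | ⟨l, r, ht⟩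
    exacts [⟨_, ht⟩, ⟨_, ht⟩]
  obtain ⟨q, hq⟩ := t.exists_isLeafAt
  exact ⟨p ++ q, by rw [IsLeafAt, subtree_append ht, hq], List.prefix_append p q⟩

theorem mem_inorder (T : PTree) (p : List Bool) : p ∈ T.inorder ↔ T.IsBinaryAt p := by
  induction T generalizing p with
  | leaf => cases p <;> simp [inorder, IsBinaryAt, subtree]
  | unary t ih =>
    rcases p with _ | ⟨_ | _, p⟩ <;>
      simp_all [inorder, IsBinaryAt, subtree]
  | binary l r ihl ihr =>
    rcases p with _ | ⟨_ | _, p⟩ <;>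
      simp_all [inorder, IsBinaryAt, subtree]

theorem nodup_inorder (T : PTree) : T.inorder.Nodup := by
  induction T with
  | leaf => exact List.nodup_nil
  | unary t ih => exact ih.map (List.cons_injective)
  | binary l r ihl ihr =>
    rw [inorder, List.nodup_append, List.nodup_cons]
    refine ⟨ihl.map List.cons_injective, ⟨by simp, ihr.map List.cons_injective⟩, ?_⟩
    simp only [List.mem_map, List.mem_cons]
    rintro _ ⟨p, -, rfl⟩ _ (rfl | ⟨q, -, rfl⟩) <;> simp

theorem IsUnaryAt.not_isBinaryAt (h : T.IsUnaryAt p) : ¬ T.IsBinaryAt p := by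
  rintro ⟨l, r, h'⟩
  obtain ⟨t, h⟩ := h
  simp [h] at h'

/-- Both nodes lie on the path to any leaf below `q`, which meets the cut once. -/
theorem IsCut.eq_of_prefix (hC : T.IsCut C) (hp : p ∈ C) (hq : q ∈ C) (h : p <+: q) : p = q := by
  obtain ⟨s, hs, hqs⟩ := (hC.1 q hq).exists_isLeafAt
  exact (hC.2 s hs).unique ⟨hp, h.trans hqs⟩ ⟨hq, hqs⟩

theorem IsCut.exists_comparable (hC : T.IsCut C) (hp : T.IsNodeAt p) :
    ∃ q ∈ C, q <+: p ∨ p <+: q := by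
  obtain ⟨s, hs, hps⟩ := hp.exists_isLeafAt
  obtain ⟨q, ⟨hq, hqs⟩, -⟩ := hC.2 s hs
  exact ⟨q, hq, List.prefix_or_prefix_of_prefix hqs hps⟩

theorem IsCut.nonempty (hC : T.IsCut C) : C.Nonempty := by
  obtain ⟨s, hs⟩ := T.exists_isLeafAt
  obtain ⟨q, ⟨hq, -⟩, -⟩ := hC.2 s hs
  exact ⟨q, hq⟩

end PTree

/-! ### Relative position of cuts and binary nodes -/

namespace BinaryPaintedTree

variable {m n : ℕ} (PT : BinaryPaintedTree m n)

theorem cut_subset_of_lt {k l : Fin m} (h : k < l) :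
    PT.cut l ⊆ PT.tree.stump (PT.cut k) \ PT.cut k := by
  obtain ⟨l, hl⟩ := l
  replace h : k.val + 1 ≤ l := h
  induction l, h using Nat.le_induction with
  | base => exact PT.cut_subset k ⟨_, hl⟩ rfl
  | succ l hkl ih =>
    intro p hp
    have hl' : l < m := by omega
    obtain ⟨⟨hpn, q, hq, hpq⟩, hpl⟩ := PT.cut_subset ⟨l, hl'⟩ ⟨l + 1, hl⟩ rfl hp
    obtain ⟨⟨-, r, hr, hqr⟩, hqk⟩ := ih hl' hq
    refine ⟨⟨hpn, r, hr, hpq.trans hqr⟩, fun hpk => ?_⟩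
    -- If `p` were in the cut `k`, then `p = r`, so `q`, squeezed between them, would be in the cut
    -- `k` too.
    obtain rfl := (PT.isCut k).eq_of_prefix hpk hr (hpq.trans hqr)
    exact hqk (by rwa [hqr.eq_of_length_le hpq.length_le])

theorem le_of_prefix {k l : Fin m} {p q : List Bool} (hp : p ∈ PT.cut k) (hq : q ∈ PT.cut l)
    (h : q <+: p) : k ≤ l := by
  by_contra! hlk
  obtain ⟨⟨-, q', hq', hpq⟩, hpl⟩ := PT.cut_subset_of_lt hlk hp
  obtain rfl := (PT.isCut l).eq_of_prefix hq hq' (h.trans hpq)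
  exact hpl (by rwa [hpq.eq_of_length_le h.length_le])

theorem exists_prolongation {k l : Fin m} (h : k ≤ l) {q : List Bool} (hq : q ∈ PT.cut l) :
    ∃ p ∈ PT.cut k, q <+: p := by
  rcases h.eq_or_lt with rfl | h
  · exact ⟨q, hq, List.prefix_rfl⟩
  · exact (PT.cut_subset_of_lt h hq).1.2

theorem exists_prefix {k l : Fin m} (h : k ≤ l) {p : List Bool} (hp : p ∈ PT.cut k) :
    ∃ q ∈ PT.cut l, q <+: p := by
  obtain ⟨q, hq, hqp | hpq⟩ := (PT.isCut l).exists_comparable ((PT.isCut k).1 p hp)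
  · exact ⟨q, hq, hqp⟩
  · obtain ⟨p', hp', hqp'⟩ := PT.exists_prolongation h hq
    obtain rfl := (PT.isCut k).eq_of_prefix hp hp' (hpq.trans hqp')
    exact ⟨q, hq, hqp'⟩

theorem node_injective : Function.Injective PT.node := by
  intro i j h
  exact Fin.ext ((PT.tree.nodup_inorder.getElem_inj_iff).1 h)

theorem isBinaryAt_node (j : Fin n) : PT.tree.IsBinaryAt (PT.node j) :=
  (PT.tree.mem_inorder _).1 (List.getElem_mem _)

theorem exists_node_eq {p : List Bool} (hp : PT.tree.IsBinaryAt p) : ∃ j, PT.node j = p := by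
  obtain ⟨i, hi, rfl⟩ := List.getElem_of_mem ((PT.tree.mem_inorder p).2 hp)
  have := PT.tree.length_inorder
  have := PT.numLeaves_tree
  exact ⟨⟨i, by omega⟩, rfl⟩

/-- The binary node labeled by `j` is below the cut labeled by `a`. -/
def NodeBelowCut (a : Fin m) (j : Fin n) : Prop := ∃ q ∈ PT.cutLabeled a, q <+: PT.node j

/-- Some node of a cut is comparable with any given node. Both directions cannot occur, since the
binary node would then belong to the cut, whose nodes are unary. -/
theorem not_nodeBelowCut_iff {a : Fin m} {j : Fin n} :
    ¬ PT.NodeBelowCut a j ↔ ∃ q ∈ PT.cutLabeled a, PT.node j <+: q := by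
  have hcut := PT.isCut (PT.label.symm a)
  constructor
  · intro h
    obtain ⟨q, hq, hqj | hjq⟩ := hcut.exists_comparable (Or.inr (PT.isBinaryAt_node j))
    · exact absurd ⟨q, hq, hqj⟩ h
    · exact ⟨q, hq, hjq⟩
  · rintro ⟨q, hq, hjq⟩ ⟨p, hp, hpj⟩
    obtain rfl := hcut.eq_of_prefix hp hq (hpj.trans hjq)
    have hunary := PT.unary_of_mem p (hcut.1 p hp) ⟨_, hp⟩
    rw [hpj.eq_of_length_le hjq.length_le] at hunary
    exact hunary.not_isBinaryAt (PT.isBinaryAt_node j)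

/-- Cuts are indexed from the leaves towards the root, starting at `0`. -/
theorem numCutsBelowCut_eq (a : Fin m) : PT.numCutsBelowCut a = (PT.label.symm a).val + 1 := by
  have : {b : Fin m | ∀ p ∈ PT.cutLabeled b, ∃ q ∈ PT.cutLabeled a, q <+: p} =
      PT.label '' Set.Iic (PT.label.symm a) := by
    ext b
    rw [Equiv.image_eq_preimage_symm]
    constructor
    · intro h
      obtain ⟨p, hp⟩ := (PT.isCut (PT.label.symm b)).nonempty
      obtain ⟨q, hq, hqp⟩ := h p hp
      exact PT.le_of_prefix hp hq hqp
    · exact fun h p hp => PT.exists_prefix h hp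
  rw [numCutsBelowCut, this, Set.ncard_image_of_injective _ PT.label.injective,
    Set.ncard_eq_toFinset_card']
  simp

theorem numNodesBelowCut_eq (a : Fin m) :
    PT.numNodesBelowCut a = {j | PT.NodeBelowCut a j}.ncard := by
  rw [numNodesBelowCut, ← Set.ncard_image_of_injective _ PT.node_injective]
  congr 1
  ext p
  constructor
  · rintro ⟨hp, h⟩
    obtain ⟨j, rfl⟩ := PT.exists_node_eq hp
    exact ⟨j, h, rfl⟩
  · rintro ⟨j, h, rfl⟩
    exact ⟨PT.isBinaryAt_node j, h⟩

theorem numCutsBelowNode_eq (j : Fin n) :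
    PT.numCutsBelowNode (PT.node j) = {a | ¬ PT.NodeBelowCut a j}.ncard := by
  simp only [not_nodeBelowCut_iff]
  rfl

/-- The generating relations of the preposet. -/
def Below (i j : Fin (m + n)) : Prop :=
  ∃ p ∈ PT.nodesLabeled i, ∃ q ∈ PT.nodesLabeled j, q <+: p

theorem below_cut_cut {a b : Fin m} :
    PT.Below (Fin.castAdd n a) (Fin.castAdd n b) ↔ PT.label.symm a ≤ PT.label.symm b := by
  simp only [Below, nodesLabeled, Fin.addCases_left]
  constructor
  · rintro ⟨p, hp, q, hq, h⟩
    exact PT.le_of_prefix hp hq h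
  · intro h
    obtain ⟨p, hp⟩ := (PT.isCut (PT.label.symm a)).nonempty
    exact ⟨p, hp, PT.exists_prefix h hp⟩

theorem below_node_cut {j : Fin n} {a : Fin m} :
    PT.Below (Fin.natAdd m j) (Fin.castAdd n a) ↔ PT.NodeBelowCut a j := by
  simp [Below, nodesLabeled, NodeBelowCut]

theorem below_cut_node {a : Fin m} {j : Fin n} :
    PT.Below (Fin.castAdd n a) (Fin.natAdd m j) ↔ ¬ PT.NodeBelowCut a j := by
  simp [Below, nodesLabeled, not_nodeBelowCut_iff]

theorem below_node_node {i j : Fin n} :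
    PT.Below (Fin.natAdd m i) (Fin.natAdd m j) ↔ PT.node j <+: PT.node i := by
  simp [Below, nodesLabeled]

/-- The inequalities are reflexive and transitive, so the generating relations suffice. -/
theorem mem_cone_iff {x : Fin (m + n) → ℝ} :
    x ∈ PT.cone ↔ ∀ i j, PT.Below i j → x i ≤ x j := by
  constructor
  · exact fun h i j hij => h i j (Relation.ReflTransGen.single hij)
  · intro h i j hij
    induction hij with
    | refl => exact le_rfl
    | tail _ hjk ih => exact ih.trans (h _ _ hjk)

/-! ### The vertex and its normal cone -/

open Classical in
/-- The endpoint of the segment `[e_a, e_{m+j}]` that belongs to the painted tree. -/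
noncomputable def segmentEnd (a : Fin m) (j : Fin n) : Fin (m + n) → ℝ :=
  if PT.NodeBelowCut a j then Pi.single (Fin.castAdd n a) 1 else Pi.single (Fin.natAdd m j) 1

/-- The vertex of the multiplihedron that belongs to the painted tree. -/
noncomputable def vertex : Fin (m + n) → ℝ :=
  Fin.append (fun a => ((PT.label.symm a).val : ℝ) + 1) (PT.tree.leafProducts PT.numLeaves_tree) +
    ∑ a, ∑ j, PT.segmentEnd a j

theorem segmentEnd_mem (a : Fin m) (j : Fin n) :
    PT.segmentEnd a j ∈
      segment ℝ (Pi.single (Fin.castAdd n a) 1 : Fin (m + n) → ℝ) (Pi.single (Fin.natAdd m j) 1) := by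
  rw [segmentEnd]
  split_ifs
  exacts [left_mem_segment ℝ _ _, right_mem_segment ℝ _ _]

theorem append_mem_product :
    Fin.append (fun a => ((PT.label.symm a).val : ℝ) + 1)
        (PT.tree.leafProducts PT.numLeaves_tree) ∈
      {x | ∃ p ∈ permutahedron m, ∃ q ∈ associahedron n, x = Fin.append p q} :=
  ⟨_, perm_mem_permutahedron PT.label, _, PT.tree.leafProducts_mem_associahedron _, rfl⟩

theorem sum_segmentEnd_mem (a : Fin m) :
    ∑ j, PT.segmentEnd a j ∈ ∑ j : Fin n,
      segment ℝ (Pi.single (Fin.castAdd n a) 1 : Fin (m + n) → ℝ) (Pi.single (Fin.natAdd m j) 1) :=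
  Set.finsetSum_mem_finsetSum _ _ _ fun j _ => PT.segmentEnd_mem a j

theorem vertex_mem : PT.vertex ∈ multiplihedron m n :=
  Set.add_mem_add PT.append_mem_product
    (Set.finsetSum_mem_finsetSum _ _ _ fun a _ => PT.sum_segmentEnd_mem a)

theorem mem_normalCone_segmentEnd {a : Fin m} {j : Fin n} {x : Fin (m + n) → ℝ} :
    x ∈ normalCone (segment ℝ (Pi.single (Fin.castAdd n a) 1) (Pi.single (Fin.natAdd m j) 1))
        {PT.segmentEnd a j} ↔
      (PT.NodeBelowCut a j → x (Fin.natAdd m j) ≤ x (Fin.castAdd n a)) ∧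
        (¬ PT.NodeBelowCut a j → x (Fin.castAdd n a) ≤ x (Fin.natAdd m j)) := by
  by_cases h : PT.NodeBelowCut a j
  · simp [segmentEnd, h, normalCone_segment_left]
  · simp [segmentEnd, h, normalCone_segment_right]

/-- The permutahedron yields the cut–cut inequalities, the associahedron the node–node ones, and the
segments the mixed ones in both directions. -/
theorem normalCone_vertex : normalCone (multiplihedron m n) {PT.vertex} = PT.cone := by
  rw [multiplihedron, shuffle, vertex, normalCone_add PT.append_mem_product
      (Set.finsetSum_mem_finsetSum _ _ _ fun a _ => PT.sum_segmentEnd_mem a),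
    normalCone_sum _ PT.sum_segmentEnd_mem,
    normalCone_append (perm_mem_permutahedron PT.label)
      (PT.tree.leafProducts_mem_associahedron PT.numLeaves_tree),
    normalCone_permutahedron, PTree.normalCone_associahedron]
  simp only [normalCone_sum _ (PT.segmentEnd_mem _)]
  ext x
  simp only [Set.mem_inter_iff, Set.mem_ofPred_eq, Finset.mem_univ, true_imp_iff,
    mem_normalCone_segmentEnd, mem_cone_iff]
  constructor
  · rintro ⟨⟨hcut, hnode⟩, hmix⟩ i j
    induction i using Fin.addCases with
    | left a =>
      induction j using Fin.addCases with
      | left b =>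
        intro h
        simpa using hcut (PT.below_cut_cut.1 h)
      | right j => exact fun h => (hmix a j).2 (PT.below_cut_node.1 h)
    | right i =>
      induction j using Fin.addCases with
      | left b => exact fun h => (hmix b i).1 (PT.below_node_cut.1 h)
      | right j => exact fun h => hnode i j (PT.below_node_node.1 h)
  · intro h
    refine ⟨⟨fun k l hkl => h _ _ (PT.below_cut_cut.2 (by simpa using hkl)),
      fun i j hij => h _ _ (PT.below_node_node.2 hij)⟩, fun a j =>
      ⟨fun ha => h _ _ (PT.below_node_cut.2 ha), fun ha => h _ _ (PT.below_cut_node.2 ha)⟩⟩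

/-! ### An interior point of the cone, and uniqueness -/

/-- A function on the labels that strictly increases towards the root. -/
noncomputable def height : Fin (m + n) → ℕ :=
  -- Lexicographic: first the number of cuts (weakly) below, then the number of binary descendants.
  -- The latter lies between `1` and `n`, so the weight `n + 1` makes the cut count dominate.
  Fin.append (fun a => ((PT.label.symm a).val + 1) * (n + 1)) fun j =>
    {a | ¬ PT.NodeBelowCut a j}.ncard * (n + 1) + {i | PT.node j <+: PT.node i}.ncard

theorem ncard_cutsBelow_le {a : Fin m} {j : Fin n} (h : PT.NodeBelowCut a j) :
    {b | ¬ PT.NodeBelowCut b j}.ncard ≤ (PT.label.symm a).val := by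
  have hsub : {b | ¬ PT.NodeBelowCut b j} ⊆ PT.label '' Set.Iio (PT.label.symm a) := by
    intro b hb
    rw [Equiv.image_eq_preimage_symm]
    refine lt_of_not_ge (α := Fin m) fun hab => hb ?_
    obtain ⟨q, hq, hqj⟩ := h
    obtain ⟨p, hp, hpq⟩ := PT.exists_prefix hab hq
    exact ⟨p, hp, hpq.trans hqj⟩
  refine (Set.ncard_le_ncard hsub).trans ?_
  rw [Set.ncard_image_of_injective _ PT.label.injective, Set.ncard_eq_toFinset_card']
  simp

theorem succ_le_ncard_cutsBelow {a : Fin m} {j : Fin n} (h : ¬ PT.NodeBelowCut a j) :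
    (PT.label.symm a).val + 1 ≤ {b | ¬ PT.NodeBelowCut b j}.ncard := by
  have hsub : PT.label '' Set.Iic (PT.label.symm a) ⊆ {b | ¬ PT.NodeBelowCut b j} := by
    rw [Equiv.image_eq_preimage_symm]
    intro b hb
    obtain ⟨q, hq, hjq⟩ := PT.not_nodeBelowCut_iff.1 h
    obtain ⟨p, hp, hqp⟩ := PT.exists_prolongation hb hq
    exact PT.not_nodeBelowCut_iff.2 ⟨p, hp, hjq.trans hqp⟩
  refine le_trans ?_ (Set.ncard_le_ncard hsub)
  rw [Set.ncard_image_of_injective _ PT.label.injective, Set.ncard_eq_toFinset_card']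
  simp

theorem height_lt {i j : Fin (m + n)} (h : PT.Below i j) (hne : i ≠ j) :
    PT.height i < PT.height j := by
  have hpos : ∀ j : Fin n, 0 < {i | PT.node j <+: PT.node i}.ncard := fun j =>
    (Set.ncard_pos).2 ⟨j, List.prefix_rfl⟩
  induction i using Fin.addCases with
  | left a =>
    induction j using Fin.addCases with
    | left b =>
      have hab := PT.below_cut_cut.1 h
      have hlt : PT.label.symm a < PT.label.symm b :=
        lt_of_le_of_ne hab fun he => hne (by rw [PT.label.symm.injective he])
      simp only [height, Fin.append_left]
      exact Nat.mul_lt_mul_of_pos_right (by simpa using hlt) (by omega)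
    | right j =>
      have := Nat.mul_le_mul_right (n + 1) (PT.succ_le_ncard_cutsBelow (PT.below_cut_node.1 h))
      have := hpos j
      simp only [height, Fin.append_left, Fin.append_right]
      omega
  | right i =>
    induction j using Fin.addCases with
    | left b =>
      have := Nat.mul_le_mul_right (n + 1) (PT.ncard_cutsBelow_le (PT.below_node_cut.1 h))
      have : {k | PT.node i <+: PT.node k}.ncard ≤ n := by
        simpa using Set.ncard_le_card {k | PT.node i <+: PT.node k}
      simp only [height, Fin.append_left, Fin.append_right]
      rw [add_mul]
      omega
    | right j =>
      have hij := PT.below_node_node.1 h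
      have h₁ : {a | ¬ PT.NodeBelowCut a i}.ncard ≤ {a | ¬ PT.NodeBelowCut a j}.ncard := by
        refine Set.ncard_le_ncard fun a ha => ?_
        obtain ⟨q, hq, hiq⟩ := PT.not_nodeBelowCut_iff.1 ha
        exact PT.not_nodeBelowCut_iff.2 ⟨q, hq, hij.trans hiq⟩
      have h₂ : {k | PT.node i <+: PT.node k}.ncard < {k | PT.node j <+: PT.node k}.ncard := by
        refine Set.ncard_lt_ncard ⟨fun k hk => hij.trans hk, fun hsub => hne ?_⟩
        have hji : PT.node i <+: PT.node j := hsub (List.prefix_rfl : PT.node j <+: PT.node j)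
        rw [PT.node_injective (hji.eq_of_length_le hij.length_le)]
      have := Nat.mul_le_mul_right (n + 1) h₁
      simp only [height, Fin.append_right]
      omega

/-- Strict inequalities between integers leave a gap of `1`, which absorbs `d`; applied with `d = ±
e_i` and `d = 0`. -/
theorem height_add_mem_cone {d : Fin (m + n) → ℝ} (hd : ∀ i j, d i - d j ≤ 1) :
    (fun i => (PT.height i : ℝ)) + d ∈ PT.cone := by
  rw [mem_cone_iff]
  intro i j hij
  rcases eq_or_ne i j with rfl | hne
  · exact le_rfl
  · have h : (PT.height i : ℝ) + 1 ≤ PT.height j := by exact_mod_cast PT.height_lt hij hne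
    have := hd i j
    simp only [Pi.add_apply]
    linarith

theorem height_add_single_mem (i : Fin (m + n)) :
    (fun i => (PT.height i : ℝ)) + Pi.single i 1 ∈ normalCone (multiplihedron m n) {PT.vertex} := by
  rw [normalCone_vertex]
  refine PT.height_add_mem_cone fun j k => ?_
  simp only [Pi.single_apply]
  split_ifs <;> norm_num

theorem height_sub_single_mem (i : Fin (m + n)) :
    (fun i => (PT.height i : ℝ)) - Pi.single i 1 ∈ normalCone (multiplihedron m n) {PT.vertex} := by
  rw [normalCone_vertex, sub_eq_add_neg]
  refine PT.height_add_mem_cone fun j k => ?_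
  simp only [Pi.neg_apply, Pi.single_apply]
  split_ifs <;> norm_num

theorem height_mem : (fun i => (PT.height i : ℝ)) ∈ normalCone (multiplihedron m n) {PT.vertex} := by
  rw [normalCone_vertex]
  simpa using PT.height_add_mem_cone (d := 0) (by simp)

theorem isCorrespondingVertex_iff {w : Fin (m + n) → ℝ} :
    PT.IsCorrespondingVertex w ↔ w = PT.vertex := by
  constructor
  · rintro ⟨hw, hcone⟩
    -- A point with the same normal cone also maximizes `height`, whose only maximizer is the
    -- vertex.
    have hx := PT.height_mem
    rw [normalCone_vertex, ← hcone, mem_normalCone_singleton] at hx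
    exact eq_of_dotProduct_le PT.height_add_single_mem PT.height_sub_single_mem
      (exposedPoints_subset hw) (hx _ PT.vertex_mem)
  · rintro rfl
    exact ⟨mem_exposedPoints_of_normalCone PT.vertex_mem PT.height_mem PT.height_add_single_mem
      PT.height_sub_single_mem, PT.normalCone_vertex⟩

/-! ### Coordinates and their sum -/

theorem vertex_castAdd (a : Fin m) :
    PT.vertex (Fin.castAdd n a) = (PT.numNodesBelowCut a : ℝ) + (PT.numCutsBelowCut a : ℝ) := by
  classical
  have h : ∀ b j, PT.segmentEnd b j (Fin.castAdd n a) =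
      if b = a then if PT.NodeBelowCut b j then (1 : ℝ) else 0 else 0 := by
    intro b j
    by_cases hb : PT.NodeBelowCut b j
    · simp [segmentEnd, hb, Pi.single_apply, eq_comm]
    · have : Fin.castAdd n a ≠ Fin.natAdd m j := by
        simp [Fin.ext_iff]
        omega
      simp [segmentEnd, hb, this]
  rw [numNodesBelowCut_eq, numCutsBelowCut_eq, Set.ncard_eq_toFinset_card']
  simp only [vertex, Pi.add_apply, Finset.sum_apply, h, Fin.append_left]
  rw [Finset.sum_comm]
  simp
  ring

theorem vertex_natAdd (j : Fin n) :
    PT.vertex (Fin.natAdd m j) = (PT.numCutsBelowNode (PT.node j) : ℝ) +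
      (PT.tree.leftLeaves (PT.node j) : ℝ) * (PT.tree.rightLeaves (PT.node j) : ℝ) := by
  classical
  have h : ∀ a i, PT.segmentEnd a i (Fin.natAdd m j) =
      if i = j then if ¬ PT.NodeBelowCut a i then (1 : ℝ) else 0 else 0 := by
    intro a i
    by_cases ha : PT.NodeBelowCut a i
    · have : Fin.natAdd m j ≠ Fin.castAdd n a := by
        simp [Fin.ext_iff]
        omega
      simp [segmentEnd, ha, this]
    · simp [segmentEnd, ha, Pi.single_apply, eq_comm]
  rw [numCutsBelowNode_eq, Set.ncard_eq_toFinset_card', add_comm]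
  simp only [vertex, Pi.add_apply, Finset.sum_apply, h, Fin.append_right]
  congr 1
  simp [← Finset.sum_boole]

theorem sum_vertex :
    ∑ i, PT.vertex i = ((m + 1).choose 2 : ℝ) + ((n + 1).choose 2 : ℝ) + (m : ℝ) * (n : ℝ) := by
  -- Either endpoint has coordinate sum `1`, so the `m * n` segments contribute `m * n`.
  have hseg : ∀ a j, ∑ i, PT.segmentEnd a j i = 1 := by
    intro a j
    rw [segmentEnd]
    split_ifs <;> simp
  have hperm : ∑ a, (((PT.label.symm a).val : ℝ) + 1) = ((m + 1).choose 2 : ℝ) := by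
    rw [Equiv.sum_comp PT.label.symm fun k => (k.val : ℝ) + 1,
      Fin.sum_univ_eq_sum_range fun k => (k : ℝ) + 1]
    have := Finset.sum_range_id (m + 1)
    rw [Finset.sum_range_succ'] at this
    rw [Nat.choose_two_right, ← this]
    simp
  have hsum : ∑ i, (∑ a, ∑ j, PT.segmentEnd a j) i = (m : ℝ) * n := by
    simp only [Finset.sum_apply]
    rw [Finset.sum_comm]
    simp_rw [Finset.sum_comm (s := (Finset.univ : Finset (Fin (m + n)))), hseg]
    simp
  simp only [vertex, Pi.add_apply, Finset.sum_add_distrib, hsum, Fin.sum_univ_add,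
    Fin.append_left, Fin.append_right, PTree.sum_leafProducts, ← hperm]

end BinaryPaintedTree

theorem mainTheorem7 (m n : ℕ) (PT : BinaryPaintedTree m n) :
    ∃ v : Fin (m + n) → ℝ,
      (∀ w : Fin (m + n) → ℝ, PT.IsCorrespondingVertex w ↔ w = v) ∧
      (∀ a : Fin m, v (Fin.castAdd n a) =
        (PT.numNodesBelowCut a : ℝ) + (PT.numCutsBelowCut a : ℝ)) ∧
      (∀ j : Fin n, v (Fin.natAdd m j) =
        (PT.numCutsBelowNode (PT.node j) : ℝ) +
          (PT.tree.leftLeaves (PT.node j) : ℝ) * (PT.tree.rightLeaves (PT.node j) : ℝ)) ∧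
      ∑ i, v i = ((m + 1).choose 2 : ℝ) + ((n + 1).choose 2 : ℝ) + (m : ℝ) * (n : ℝ) :=
  ⟨PT.vertex, fun _ => PT.isCorrespondingVertex_iff, PT.vertex_castAdd, PT.vertex_natAdd,
    PT.sum_vertex⟩
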